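/- Let $A$ and $B$ be finite-dimensional quantum systems, let $|B|$ be the dimension of $\mathcal H_B$, and let $\rho_{AB}$ be a state (density matrix) on $\mathcal H_A\otimes\mathcal H_B$. Write $F(\sigma,\rho)=\operatorname{Tr}\sqrt{\sqrt\rho\,\sigma\sqrt\rho}$ for the fidelity, and, for a linear map $\Lambda$ on $L(\mathcal H_B)$, write $\Lambda_B[\rho_{AB}]=(\mathrm{id}_A\otimes\Lambda)[\rho_{AB}]$. A channel is a completely positive trace-preserving linear map. Let $\mathcal L^{\mathrm{EB}}$ be the class of entanglement-breaking (measure-and-prepare) maps $\Lambda[\cdot]=\sum_y \operatorname{Tr}(M_y\,\cdot)\,|\beta_y\rangle\langle\beta_y|$ on $L(\mathcal H_B)$, where $\{M_y\}$ is a finite POVM and the $|\beta_y\rangle\in\mathcal H_B$ are unit vectors. For $k\ge 1$, let $B^k=B_1\cdots B_k$ be $k$ copies of $B$, let $\Pi^+_{B^k}$ be the projector onto the fully symmetric subspace of $\mathcal H_B^{\otimes k}$, and let $\mathcal L^{\mathrm{Sym}_+(k)}$ be the class of $k$-Bose-symmetric extendible maps on $L(\mathcal H_B)$: the maps $\Lambda=\operatorname{Tr}_{B_2\cdots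 B_k}\circ\,\Gamma$, where $\Gamma:L(\mathcal H_B)\to L(\mathcal H_B^{\otimes k})$ is a channel with $\Gamma[X]=\Pi^+_{B^k}\,\Gamma[X]\,\Pi^+_{B^k}$ for all $X$. For a class $\mathcal L$ of channels put $$D_{F,\mathcal L}:=-\log_2\ \sup_{\Lambda\in\mathcal L}F\big(\Lambda_B[\rho_{AB}],\rho_{AB}\big)^2 ,$$ so that $D_F:=D_{F,\mathcal L^{\mathrm{EB}}}$ is the surprisal of measurement recoverability of $\rho_{AB}$. Theorem. For every $k\ge 1$, $$\sup_{\Lambda\in\mathcal L^{\mathrm{EB}}}F\big(\rho_{AB},\Lambda_B[\rho_{AB}]\big)\ \ge\ \sup_{\Lambda\in\mathcal L^{\mathrm{Sym}_+(k)}}F\big(\rho_{AB},\Lambda_B[\rho_{AB}]\big)-\sqrt{\frac{2|B|}{k}} ,$$ where both suprema are finite and strictly positive (so that the logarithms above are well defined). Consequently $D_{F,\mathcal L^{\mathrm{Sym}_+(k)}}\to D_F$ as $k\to\infty$. -/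

import Mathlib

open Filter Topology
open scoped ComplexOrder

noncomputable section

namespace QDiscord

/- A finite-dimensional quantum system is represented by a finite index type `b` (an orthonormal
basis of its Hilbert space); operators on it are the matrices `Matrix b b ℂ`, and a composite
system has the product of the index types as its index type. -/

/-- Quantum states (density matrices). -/
def IsState {a : Type*} [Fintype a] (ρ : Matrix a a ℂ) : Prop :=
  ρ.PosSemidef ∧ ρ.trace = 1

/-- The map `id_A ⊗ Λ`, which applies `Λ` to each block of an operator on `A ⊗ B`. -/
def idTensor (a : Type*) {b c : Type*} (Λ : Matrix b b ℂ →ₗ[ℂ] Matrix c c ℂ) :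
    Matrix (a × b) (a × b) ℂ →ₗ[ℂ] Matrix (a × c) (a × c) ℂ where
  toFun X := Matrix.of fun s t => Λ (Matrix.of fun u v => X (s.1, u) (t.1, v)) s.2 t.2
  map_add' X Y := by
    ext s t
    exact congrFun (congrFun (Λ.map_add (Matrix.of fun u v => X (s.1, u) (t.1, v))
      (Matrix.of fun u v => Y (s.1, u) (t.1, v))) s.2) t.2
  map_smul' z X := by
    ext s t
    exact congrFun (congrFun (Λ.map_smul z (Matrix.of fun u v => X (s.1, u) (t.1, v))) s.2) t.2

/-- Channels: completely positive and trace-preserving linear maps. -/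
def IsChannel {b c : Type*} [Fintype b] [Fintype c]
    (Λ : Matrix b b ℂ →ₗ[ℂ] Matrix c c ℂ) : Prop :=
  (∀ (n : ℕ) (X : Matrix (Fin n × b) (Fin n × b) ℂ),
    X.PosSemidef → (idTensor (Fin n) Λ X).PosSemidef) ∧
  ∀ X : Matrix b b ℂ, (Λ X).trace = X.trace

/-- The unitary that permutes the `k` copies of `B` in `B^k`; the index type of `B^k` is
`Fin k → b`. -/
def permUnitary {b : Type*} [DecidableEq b] {k : ℕ} (π : Equiv.Perm (Fin k)) :
    Matrix (Fin k → b) (Fin k → b) ℂ :=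
  Matrix.of fun f g => if f = g ∘ π then 1 else 0

/-- The projector `Π⁺` onto the fully symmetric subspace of `B^k`: the average of the permutation
unitaries. -/
def symProj (b : Type*) [DecidableEq b] (k : ℕ) : Matrix (Fin k → b) (Fin k → b) ℂ :=
  ((Nat.factorial k : ℂ))⁻¹ • ∑ π : Equiv.Perm (Fin k), permUnitary π

/-- The partial trace over all the copies of `B` in `B^k` except the copy `i`. -/
def traceOthers {b : Type*} [Fintype b] [DecidableEq b] {k : ℕ} (i : Fin k)
    (X : Matrix (Fin k → b) (Fin k → b) ℂ) : Matrix b b ℂ :=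
  Matrix.of fun p q => ∑ f : Fin k → b, if f i = p then X f (Function.update f i q) else 0

/-- The class of `k`-Bose-symmetric extendible maps: the first marginals of channels from `B` into
the fully symmetric subspace of `B^k`. (It is empty for `k = 0`, where there is no copy `B₁`.) -/
def boseExtendible (b : Type*) [Fintype b] [DecidableEq b] (k : ℕ) :
    Set (Matrix b b ℂ →ₗ[ℂ] Matrix b b ℂ) :=
  {Λ | ∃ hk : 0 < k, ∃ Γ : Matrix b b ℂ →ₗ[ℂ] Matrix (Fin k → b) (Fin k → b) ℂ,
    IsChannel Γ ∧
    (∀ X, Γ X = symProj b k * Γ X * symProj b k) ∧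
    ∀ X, Λ X = traceOthers ⟨0, hk⟩ (Γ X)}

/-- The class of entanglement-breaking (measure-and-prepare) maps
`X ↦ ∑ y, Tr (M y * X) |β y⟩⟨β y|` with a POVM `M` and unit vectors `β y`. -/
def entanglementBreaking (b : Type*) [Fintype b] [DecidableEq b] :
    Set (Matrix b b ℂ →ₗ[ℂ] Matrix b b ℂ) :=
  {Λ | ∃ (n : ℕ) (M : Fin n → Matrix b b ℂ) (β : Fin n → b → ℂ),
    (∀ y, (M y).PosSemidef) ∧ ∑ y, M y = 1 ∧
    (∀ y, ∑ i, ‖β y i‖ ^ 2 = 1) ∧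
    ∀ X, Λ X = ∑ y, (M y * X).trace • Matrix.vecMulVec (β y) (star (β y))}

open scoped MatrixOrder in
/-- The fidelity `F(σ, ρ) = Tr √(√ρ σ √ρ)`. -/
def fidelity {a : Type*} [Fintype a] [DecidableEq a] (σ ρ : Matrix a a ℂ) : ℝ :=
  (CFC.sqrt (CFC.sqrt ρ * σ * CFC.sqrt ρ)).trace.re

/-- `sup_{Λ ∈ L} F(ρ_AB, Λ_B[ρ_AB])`. -/
def supFidelity {a b : Type*} [Fintype a] [DecidableEq a] [Fintype b] [DecidableEq b]
    (L : Set (Matrix b b ℂ →ₗ[ℂ] Matrix b b ℂ)) (ρ : Matrix (a × b) (a × b) ℂ) : ℝ :=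
  sSup ((fun Λ => fidelity ρ (idTensor a Λ ρ)) '' L)

/-- `D_{F,L} = - log₂ sup_{Λ ∈ L} F(Λ_B[ρ_AB], ρ_AB)²`; for the class `L` of
entanglement-breaking maps this is the surprisal of measurement recoverability. -/
def surprisal {a b : Type*} [Fintype a] [DecidableEq a] [Fintype b] [DecidableEq b]
    (L : Set (Matrix b b ℂ →ₗ[ℂ] Matrix b b ℂ)) (ρ : Matrix (a × b) (a × b) ℂ) : ℝ :=
  -Real.logb 2 (sSup ((fun Λ => fidelity (idTensor a Λ ρ) ρ ^ 2) '' L))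

end QDiscord

end

/-! Let d = |B|. Given a Bose-symmetric extension Γ of Λ, measure its k output copies with a POVM
made of tensor powers ψ^{⊗k} and prepare the ψ that was found. On the symmetric subspace this
measure-and-prepare map is exactly Λ' = k/(k+d) Λ + 1/(k+d) Tr(·) 1
(`exists_entanglementBreaking_of_mem_boseExtendible`). Hence Λ'_B[ρ] ≥ k/(k+d) Λ_B[ρ] as operators.
Fidelity is monotone and scales by the square root of a factor, so F' ≥ √(k/(k+d)) F. As F ≤ 1, the
loss is at most 1 - √(k/(k+d)) ≤ √(2d/k).

The formula for Λ' follows from a Wick identity: for a standard complex Gaussian vector ψ, the mean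
of |ψ⟩⟨ψ|^{⊗(k+1)} is the sum of all permutation unitaries. The sum is then split by where a
permutation sends the prepared copy. POVMs must be finite here, so the Gaussian is replaced by a
quadrature exact in the needed degrees (`exists_symmetric_design`), built from Gauss–Laguerre nodes
for |z|² and roots of unity for the phase.

Conversely, preparing β^{⊗k} instead of β makes every entanglement-breaking map extendible. The two
suprema are thus squeezed together, and the surprisals converge because the limiting supremum is
positive. -/

namespace QDiscord

/-! ### Fidelity: bounds, monotonicity, scaling, symmetry -/

section Fidelity

open scoped MatrixOrder
open Matrix

variable {n : Type*} [Fintype n] [DecidableEq n]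

theorem posSemidef_sqrt (Y : Matrix n n ℂ) : (CFC.sqrt Y).PosSemidef :=
  nonneg_iff_posSemidef.1 (CFC.sqrt_nonneg Y)

theorem sqrt_mul_sqrt_of_posSemidef {Y : Matrix n n ℂ} (hY : Y.PosSemidef) :
    CFC.sqrt Y * CFC.sqrt Y = Y :=
  CFC.sqrt_mul_sqrt_self Y (nonneg_iff_posSemidef.2 hY)

theorem trace_mul_nonneg_of_posSemidef {A B : Matrix n n ℂ} (hA : A.PosSemidef)
    (hB : B.PosSemidef) : 0 ≤ (A * B).trace := by
  have h := (hB.conjTranspose_mul_mul_same (CFC.sqrt A)).trace_nonneg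
  rwa [(posSemidef_sqrt A).1.eq, Matrix.mul_assoc, trace_mul_comm, Matrix.mul_assoc,
    sqrt_mul_sqrt_of_posSemidef hA, trace_mul_comm] at h

theorem trace_re_mul_nonneg {A B : Matrix n n ℂ} (hA : A.PosSemidef) (hB : B.PosSemidef) :
    0 ≤ (A * B).trace.re :=
  (Complex.le_def.1 (trace_mul_nonneg_of_posSemidef hA hB)).1

/-- The variational upper bound on the trace of the square root. -/
theorem trace_sqrt_le {Y T : Matrix n n ℂ} (hY : Y.PosSemidef) (hT : T.PosDef) :
    2 * (CFC.sqrt Y).trace.re ≤ (Y * T⁻¹).trace.re + T.trace.re := by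
  set S := CFC.sqrt Y
  have hS : Sᴴ = S := (posSemidef_sqrt Y).1.eq
  have hU : IsUnit T.det := (isUnit_iff_isUnit_det _).1 hT.isUnit
  -- Completing the square: with S = √Y, the trace of (S T⁻¹ - 1) T (S T⁻¹ - 1)ᴴ ≥ 0 is the claim.
  have h := (hT.posSemidef.mul_mul_conjTranspose_same (S * T⁻¹ - 1)).trace_nonneg
  have e : (S * T⁻¹ - 1) * T * (S * T⁻¹ - 1)ᴴ = S * T⁻¹ * S - S - S + T := by
    rw [conjTranspose_sub, conjTranspose_mul, hS, hT.inv.1.eq, conjTranspose_one, Matrix.sub_mul,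
      Matrix.mul_assoc S, nonsing_inv_mul _ hU, Matrix.mul_one, Matrix.one_mul, Matrix.mul_sub,
      Matrix.sub_mul, Matrix.sub_mul, Matrix.mul_one, Matrix.mul_one, ← Matrix.mul_assoc T,
      mul_nonsing_inv _ hU, Matrix.one_mul, Matrix.mul_assoc]
    abel
  rw [e, trace_add, trace_sub, trace_sub, trace_mul_comm, ← Matrix.mul_assoc,
    sqrt_mul_sqrt_of_posSemidef hY] at h
  have := (Complex.le_def.1 h).1
  simp only [Complex.zero_re, Complex.add_re, Complex.sub_re] at this
  linarith

omit [Fintype n] in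
theorem posDef_add_smul_one {A : Matrix n n ℂ} (hA : A.PosSemidef) {δ : ℝ} (hδ : 0 < δ) :
    (A + (δ : ℂ) • (1 : Matrix n n ℂ)).PosDef :=
  (PosDef.one.smul (by exact_mod_cast hδ : (0 : ℂ) < (δ : ℂ))).posSemidef_add hA

theorem posSemidef_sqrt_mul_mul_sqrt {σ : Matrix n n ℂ} (hσ : σ.PosSemidef) (ρ : Matrix n n ℂ) :
    (CFC.sqrt ρ * σ * CFC.sqrt ρ).PosSemidef := by
  have := hσ.mul_mul_conjTranspose_same (CFC.sqrt ρ)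
  rwa [(posSemidef_sqrt ρ).1.eq] at this

theorem fidelity_nonneg (σ ρ : Matrix n n ℂ) : 0 ≤ fidelity σ ρ :=
  (Complex.le_def.1 (posSemidef_sqrt _).trace_nonneg).1

theorem le_of_forall_pos_le_add_mul {x y c : ℝ} (h : ∀ δ : ℝ, 0 < δ → x ≤ y + δ * c) : x ≤ y := by
  have ht : Tendsto (fun δ : ℝ => y + δ * c) (𝓝[>] 0) (𝓝 y) := by
    have : Tendsto (fun δ : ℝ => y + δ * c) (𝓝 0) (𝓝 (y + 0 * c)) :=
      (Continuous.tendsto (by fun_prop) 0)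
    simpa using this.mono_left nhdsWithin_le_nhds
  exact ge_of_tendsto ht (eventually_nhdsWithin_of_forall fun δ hδ => h δ hδ)

/-- The variational bound for Y is tested at T = √Z, which would be optimal for Z; the shift by δ
only makes T invertible. -/
theorem trace_sqrt_mono {Y Z : Matrix n n ℂ} (hY : Y.PosSemidef) (hYZ : (Z - Y).PosSemidef) :
    (CFC.sqrt Y).trace.re ≤ (CFC.sqrt Z).trace.re := by
  have hZ : Z.PosSemidef := by simpa using hYZ.add hY
  refine le_of_forall_pos_le_add_mul (c := (trace (1 : Matrix n n ℂ)).re / 2) fun δ hδ => ?_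
  set R := CFC.sqrt Z
  have hR := posSemidef_sqrt Z
  set T := R + (δ : ℂ) • (1 : Matrix n n ℂ) with hTdef
  have hT : T.PosDef := posDef_add_smul_one hR hδ
  have hU : IsUnit T.det := (isUnit_iff_isUnit_det _).1 hT.isUnit
  have h1 := trace_sqrt_le hY hT
  have h2 : (Y * T⁻¹).trace.re ≤ (Z * T⁻¹).trace.re := by
    have := trace_re_mul_nonneg hYZ hT.inv.posSemidef
    rw [Matrix.sub_mul, trace_sub, Complex.sub_re] at this
    linarith
  have h3 : (Z * T⁻¹).trace.re ≤ R.trace.re := by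
    have e : Z * T⁻¹ = R - (δ : ℂ) • (R * T⁻¹) := by
      have : R * T = Z + (δ : ℂ) • R := by
        rw [hTdef, Matrix.mul_add, sqrt_mul_sqrt_of_posSemidef hZ, Matrix.mul_smul, Matrix.mul_one]
      have h4 : R = (Z + (δ : ℂ) • R) * T⁻¹ := by
        rw [← this, Matrix.mul_assoc, mul_nonsing_inv _ hU, Matrix.mul_one]
      rw [Matrix.add_mul, Matrix.smul_mul] at h4
      exact eq_sub_of_add_eq h4.symm
    rw [e, trace_sub, trace_smul, smul_eq_mul, Complex.sub_re, Complex.re_ofReal_mul]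
    have := mul_nonneg hδ.le (trace_re_mul_nonneg hR hT.inv.posSemidef)
    linarith
  have h4 : T.trace.re = R.trace.re + δ * (trace (1 : Matrix n n ℂ)).re := by
    rw [hTdef, trace_add, trace_smul, smul_eq_mul, Complex.add_re, Complex.re_ofReal_mul]
  linarith

/-- The variational bound is tested at T = ρ + δ: since √ρ T⁻¹ √ρ = 1 - δ T⁻¹ ≤ 1, both terms on the
right are at most 1 up to O(δ). -/
theorem fidelity_le_one {σ ρ : Matrix n n ℂ} (hσ : IsState σ) (hρ : IsState ρ) :
    fidelity σ ρ ≤ 1 := by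
  refine le_of_forall_pos_le_add_mul (c := (trace (1 : Matrix n n ℂ)).re / 2) fun δ hδ => ?_
  set R := CFC.sqrt ρ with hRdef
  have hR : Rᴴ = R := (posSemidef_sqrt ρ).1.eq
  set T := ρ + (δ : ℂ) • (1 : Matrix n n ℂ) with hTdef
  have hT : T.PosDef := posDef_add_smul_one hρ.1 hδ
  have hU : IsUnit T.det := (isUnit_iff_isUnit_det _).1 hT.isUnit
  have h1 := trace_sqrt_le (posSemidef_sqrt_mul_mul_sqrt hσ.1 ρ) hT
  have hc : T * R = R * T := by
    rw [hTdef, Matrix.add_mul, Matrix.mul_add, Matrix.smul_mul, Matrix.mul_smul, Matrix.mul_one,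
      Matrix.one_mul]
    nth_rewrite 1 [← sqrt_mul_sqrt_of_posSemidef hρ.1]
    nth_rewrite 3 [← sqrt_mul_sqrt_of_posSemidef hρ.1]
    rw [Matrix.mul_assoc]
  have e : R * T⁻¹ * R = 1 - (δ : ℂ) • T⁻¹ := by
    have h2 : T⁻¹ * R = R * T⁻¹ := by
      calc T⁻¹ * R = T⁻¹ * (R * T) * T⁻¹ := by
            rw [Matrix.mul_assoc, Matrix.mul_assoc, mul_nonsing_inv _ hU, Matrix.mul_one]
        _ = R * T⁻¹ := by rw [← hc, ← Matrix.mul_assoc, nonsing_inv_mul _ hU, Matrix.one_mul]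
    have h3 : (ρ + (δ : ℂ) • (1 : Matrix n n ℂ)) * T⁻¹ = 1 := mul_nonsing_inv _ hU
    rw [Matrix.add_mul, Matrix.smul_mul, Matrix.one_mul] at h3
    rw [Matrix.mul_assoc, h2, ← Matrix.mul_assoc, sqrt_mul_sqrt_of_posSemidef hρ.1]
    exact eq_sub_of_add_eq h3
  have h5 : (R * σ * R * T⁻¹).trace.re ≤ 1 := by
    have e2 : (R * σ * R * T⁻¹).trace = 1 - δ * (σ * T⁻¹).trace := by
      rw [Matrix.mul_assoc R, Matrix.mul_assoc, trace_mul_comm, Matrix.mul_assoc, Matrix.mul_assoc,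
        ← Matrix.mul_assoc R, e, Matrix.mul_sub, Matrix.mul_one, Matrix.mul_smul, trace_sub,
        trace_smul, hσ.2, smul_eq_mul]
    rw [e2, Complex.sub_re, Complex.re_ofReal_mul, Complex.one_re]
    have := mul_nonneg hδ.le (trace_re_mul_nonneg hσ.1 hT.inv.posSemidef)
    linarith
  have h4 : T.trace.re = 1 + δ * (trace (1 : Matrix n n ℂ)).re := by
    rw [hTdef, trace_add, trace_smul, smul_eq_mul, Complex.add_re, Complex.re_ofReal_mul, hρ.2,
      Complex.one_re]
  have : fidelity σ ρ = (CFC.sqrt (R * σ * R)).trace.re := rfl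
  linarith

theorem fidelity_mono {σ τ : Matrix n n ℂ} (hσ : σ.PosSemidef) (h : (τ - σ).PosSemidef)
    (ρ : Matrix n n ℂ) : fidelity σ ρ ≤ fidelity τ ρ := by
  refine trace_sqrt_mono (posSemidef_sqrt_mul_mul_sqrt hσ ρ) ?_
  rw [← Matrix.sub_mul, ← Matrix.mul_sub]
  exact posSemidef_sqrt_mul_mul_sqrt h ρ

theorem fidelity_smul {c : ℝ} (hc : 0 ≤ c) {σ : Matrix n n ℂ} (hσ : σ.PosSemidef)
    (ρ : Matrix n n ℂ) : fidelity ((c : ℂ) • σ) ρ = √c * fidelity σ ρ := by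
  have h := posSemidef_sqrt_mul_mul_sqrt hσ ρ
  have hs : ((0 : ℂ)) ≤ ((√c : ℝ) : ℂ) := by exact_mod_cast Real.sqrt_nonneg c
  have e : CFC.sqrt ((c : ℂ) • (CFC.sqrt ρ * σ * CFC.sqrt ρ)) =
      ((√c : ℝ) : ℂ) • CFC.sqrt (CFC.sqrt ρ * σ * CFC.sqrt ρ) := by
    refine CFC.sqrt_unique ?_ (nonneg_iff_posSemidef.2 ((posSemidef_sqrt _).smul hs))
    rw [Matrix.smul_mul, Matrix.mul_smul, smul_smul, sqrt_mul_sqrt_of_posSemidef h,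
      ← Complex.ofReal_mul, Real.mul_self_sqrt hc]
  rw [fidelity, Matrix.mul_smul, Matrix.smul_mul, e, trace_smul, smul_eq_mul,
    Complex.re_ofReal_mul, fidelity]

/-- The trace of √Y depends only on the characteristic polynomial of Y, which AB and BA share; this
gives the symmetry of the fidelity. -/
theorem trace_sqrt_eq {Y : Matrix n n ℂ} (hY : Y.PosSemidef) :
    (CFC.sqrt Y).trace.re = (Y.charpoly.roots.map fun z => √z.re).sum := by
  rw [hY.1.roots_charpoly_eq_eigenvalues, CFC.sqrt_eq_real_sqrt Y (nonneg_iff_posSemidef.2 hY),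
    cfcₙ_eq_cfc, hY.1.cfc_eq, IsHermitian.cfc, Unitary.conjStarAlgAut_apply, trace_mul_comm,
    ← Matrix.mul_assoc, Unitary.coe_star_mul_self, Matrix.one_mul]
  simp [trace_diagonal]

theorem fidelity_comm {σ ρ : Matrix n n ℂ} (hσ : σ.PosSemidef) (hρ : ρ.PosSemidef) :
    fidelity σ ρ = fidelity ρ σ := by
  rw [fidelity, fidelity, trace_sqrt_eq (posSemidef_sqrt_mul_mul_sqrt hσ ρ),
    trace_sqrt_eq (posSemidef_sqrt_mul_mul_sqrt hρ σ)]
  have e (α β : Matrix n n ℂ) (hα : α.PosSemidef) : CFC.sqrt β * α * CFC.sqrt β =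
      (CFC.sqrt β * CFC.sqrt α) * (CFC.sqrt α * CFC.sqrt β) := by
    rw [Matrix.mul_assoc (CFC.sqrt β) (CFC.sqrt α), ← Matrix.mul_assoc (CFC.sqrt α),
      sqrt_mul_sqrt_of_posSemidef hα, Matrix.mul_assoc]
  rw [e σ ρ hσ, e ρ σ hρ, charpoly_mul_comm]

theorem fidelity_pos {σ ρ : Matrix n n ℂ} (hσ : σ.PosSemidef) (hρ : ρ.PosSemidef)
    (h : (σ * ρ).trace ≠ 0) : 0 < fidelity σ ρ := by
  refine lt_of_le_of_ne (fidelity_nonneg σ ρ) fun h0 => h ?_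
  have hY := posSemidef_sqrt_mul_mul_sqrt hσ ρ
  have hS := posSemidef_sqrt (CFC.sqrt ρ * σ * CFC.sqrt ρ)
  have ht : (CFC.sqrt (CFC.sqrt ρ * σ * CFC.sqrt ρ)).trace = 0 :=
    Complex.ext h0.symm (Complex.le_def.1 hS.trace_nonneg).2.symm
  rw [hS.trace_eq_zero_iff] at ht
  have : CFC.sqrt ρ * σ * CFC.sqrt ρ = 0 := by
    rw [← sqrt_mul_sqrt_of_posSemidef hY, ht, Matrix.mul_zero]
  rw [← sqrt_mul_sqrt_of_posSemidef hρ, ← Matrix.mul_assoc, trace_mul_comm, ← Matrix.mul_assoc,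
    this, trace_zero]

end Fidelity

/-! ### Gauss–Laguerre quadrature from a Jacobi matrix -/

section

open Matrix in
/-- The moments of the spectral measure of a positive semidefinite matrix in a coordinate
direction. -/
theorem exists_weights_forall_pow_apply {n : ℕ} {J : Matrix (Fin n) (Fin n) ℝ}
    (hJ : J.PosSemidef) (i : Fin n) :
    ∃ w x : Fin n → ℝ, (∀ j, 0 ≤ w j) ∧ (∀ j, 0 ≤ x j) ∧
      ∀ m : ℕ, ∑ j, w j * x j ^ m = (J ^ m) i i := by
  refine ⟨fun j => (hJ.1.eigenvectorUnitary : Matrix (Fin n) (Fin n) ℝ) i j ^ 2, hJ.1.eigenvalues,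
    fun j => sq_nonneg _, hJ.eigenvalues_nonneg, fun m => ?_⟩
  conv_rhs => rw [hJ.1.spectral_theorem, ← map_pow, Unitary.conjStarAlgAut_apply, diagonal_pow]
  rw [mul_apply]
  refine Finset.sum_congr rfl fun j _ => ?_
  rw [mul_diagonal, star_apply]
  simp
  ring

/-- The factors of the Laguerre Jacobi matrix. -/
def laguerreFactor (n : ℕ) (l : ℕ) : Fin n → ℝ :=
  fun i => (if (i : ℕ) = l then 1 else 0) + if (i : ℕ) = l + 1 then 1 else 0

/-- The compression of the Jacobi matrix of the Laguerre polynomials (up to signs) to the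
polynomials of degree less than `n`. -/
def laguerreJacobi (n : ℕ) : Matrix (Fin n) (Fin n) ℝ :=
  ∑ l : Fin n, ((l : ℝ) + 1) • Matrix.vecMulVec
    (laguerreFactor n l) (star (laguerreFactor n l))

/-- Positivity makes the quadrature nodes nonnegative, so that they can serve as squared moduli. -/
theorem laguerreJacobi_posSemidef (n : ℕ) : (laguerreJacobi n).PosSemidef :=
  Matrix.posSemidef_sum _ fun l _ =>
    (Matrix.posSemidef_vecMulVec_self_star _).smul (by positivity : (0 : ℝ) ≤ (l : ℝ) + 1)

/-- Truncation removes the component n from the last factor; `u n = 0` makes this harmless. At `i =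
0` the junk value `u (i - 1)` has coefficient 0. -/
theorem laguerreJacobi_mulVec {n : ℕ} (u : ℕ → ℝ) (hu : u n = 0) (i : Fin n) :
    (laguerreJacobi n).mulVec (fun j : Fin n => u j) i =
      ((i : ℝ) + 1) * (u i + u (i + 1)) + i * (u (i - 1) + u i) := by
  have h1 : ∀ l : Fin n, (∑ j : Fin n, ((if (j : ℕ) = l then (1 : ℝ) else 0) +
      if (j : ℕ) = l + 1 then 1 else 0) * u j) = u l + u (l + 1) := by
    intro l
    rw [Fin.sum_univ_eq_sum_range (fun j => ((if j = (l : ℕ) then (1 : ℝ) else 0) +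
      if j = (l : ℕ) + 1 then 1 else 0) * u j)]
    simp only [add_mul, ite_mul, one_mul, zero_mul, Finset.sum_add_distrib, Finset.sum_ite_eq',
      Finset.mem_range, l.2, if_true]
    split_ifs with h
    · rfl
    · rw [show (l : ℕ) + 1 = n by have := l.2; omega, hu]
  have h2 : (laguerreJacobi n).mulVec (fun j : Fin n => u j) i = ∑ l : Fin n, ((l : ℝ) + 1) *
      (((if (i : ℕ) = l then (1 : ℝ) else 0) + if (i : ℕ) = l + 1 then 1 else 0) *
        (u l + u (l + 1))) := by
    rw [laguerreJacobi, Matrix.sum_mulVec, Finset.sum_apply]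
    refine Finset.sum_congr rfl fun l _ => ?_
    rw [← h1 l, Matrix.smul_mulVec, Pi.smul_apply, smul_eq_mul, Matrix.mulVec, dotProduct]
    simp only [Finset.mul_sum]
    refine Finset.sum_congr rfl fun j _ => ?_
    simp only [laguerreFactor, Matrix.vecMulVec_apply, star_trivial]
    ring
  rw [h2, Fin.sum_univ_eq_sum_range (fun l => ((l : ℝ) + 1) *
      (((if (i : ℕ) = l then (1 : ℝ) else 0) + if (i : ℕ) = l + 1 then 1 else 0) *
        (u l + u (l + 1))))]
  obtain ⟨i, hi⟩ := i
  simp only [add_mul, mul_add, ite_mul, mul_ite, one_mul, zero_mul, mul_zero,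
    Finset.sum_add_distrib, Finset.sum_ite_eq, Finset.mem_range, hi, if_true]
  rcases i with _ | i
  · simp
  · have hi' : i < n := by omega
    simp [hi']
    ring

/-- Up to signs this is the Laguerre expansion x^m = m! ∑ (-1)^j C(m, j) L_j. For m < n the
truncation is never felt. The entry at 0 is the exponential moment m!. -/
theorem laguerreJacobi_pow_mulVec {n m : ℕ} (hm : m < n) :
    (laguerreJacobi n ^ m).mulVec (fun j : Fin n => if (j : ℕ) = 0 then 1 else 0) =
      fun j : Fin n => (m.factorial : ℝ) * (m.choose j : ℝ) := by
  induction m with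
  | zero =>
    ext j
    rcases j with ⟨_ | j, hj⟩ <;> simp
  | succ m ih =>
    rw [pow_succ', ← Matrix.mulVec_mulVec, ih (by omega)]
    ext i
    rw [laguerreJacobi_mulVec (fun j => (m.factorial : ℝ) * (m.choose j : ℝ))
      (by rw [Nat.choose_eq_zero_of_lt (by omega)]; simp)]
    obtain ⟨i, hi⟩ := i
    have e1 : ((i : ℝ) + 1) * ((m.choose i : ℝ) + m.choose (i + 1)) = (m + 1) * m.choose i := by
      have := Nat.add_one_mul_choose_eq m i
      rw [Nat.choose_succ_succ] at this
      have : (((m + 1) * m.choose i : ℕ) : ℝ) =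
        (((m.choose i + m.choose (i + 1)) * (i + 1) : ℕ) : ℝ) := by exact_mod_cast this
      push_cast at this
      linarith
    rcases i with _ | i
    · simp [Nat.factorial_succ] at e1 ⊢
      ring
    · have e2 : ((i : ℝ) + 1) * ((m.choose i : ℝ) + m.choose (i + 1)) = (m + 1) * m.choose i := by
        have := Nat.add_one_mul_choose_eq m i
        rw [Nat.choose_succ_succ] at this
        have : (((m + 1) * m.choose i : ℕ) : ℝ) =
          (((m.choose i + m.choose (i + 1)) * (i + 1) : ℕ) : ℝ) := by exact_mod_cast this
        push_cast at this
        linarith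
      push_cast [Nat.factorial_succ, Nat.choose_succ_succ m i] at e1 ⊢
      linear_combination (m.factorial : ℝ) * (e1 + e2)

/-- A quadrature for the exponential distribution that is exact in low degrees. -/
theorem exists_exponential_quadrature (n : ℕ) :
    ∃ w x : Fin (n + 1) → ℝ, (∀ j, 0 ≤ w j) ∧ (∀ j, 0 ≤ x j) ∧
      ∀ m ≤ n, ∑ j, w j * x j ^ m = m.factorial := by
  obtain ⟨w, x, hw, hx, h⟩ := exists_weights_forall_pow_apply (laguerreJacobi_posSemidef (n + 1)) 0
  refine ⟨w, x, hw, hx, fun m hm => ?_⟩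
  rw [h]
  have := congrFun (laguerreJacobi_pow_mulVec (n := n + 1) (m := m) (by omega)) 0
  simpa [Matrix.mulVec, dotProduct, Fin.sum_univ_succ] using this

end

/-! ### Gaussian quadrature and the symmetric design -/

section

theorem sum_pow_mul_star_pow_of_isPrimitiveRoot {N : ℕ} {ζ : ℂ} (hζ : IsPrimitiveRoot ζ N)
    {m n : ℕ} (hm : m < N) (hn : n < N) :
    ∑ t : Fin N, (ζ ^ (t : ℕ)) ^ m * star (ζ ^ (t : ℕ)) ^ n = if m = n then (N : ℂ) else 0 := by
  have hN : N ≠ 0 := by omega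
  have h1 : ζ * star ζ = 1 := by
    have := Complex.mul_conj ζ
    rw [Complex.normSq_eq_norm_sq, hζ.norm'_eq_one hN] at this
    simpa using this
  have hs : ∀ t : ℕ, (ζ ^ t) ^ m * star (ζ ^ t) ^ n = (ζ ^ m * star ζ ^ n) ^ t := by
    intro t
    rw [star_pow, mul_pow, ← pow_mul, ← pow_mul, ← pow_mul, ← pow_mul, mul_comm t m, mul_comm t n]
  simp only [hs]
  rw [Fin.sum_univ_eq_sum_range (fun t => (ζ ^ m * star ζ ^ n) ^ t)]
  split_ifs with h
  · subst h
    simp only [← mul_pow, h1, one_pow]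
    simp
  · have hr : ζ ^ m * star ζ ^ n ≠ 1 := by
      intro hr
      apply h
      apply hζ.pow_inj hm hn
      calc ζ ^ m = ζ ^ m * (ζ * star ζ) ^ n := by rw [h1, one_pow, mul_one]
        _ = (ζ ^ m * star ζ ^ n) * ζ ^ n := by rw [mul_pow]; ring
        _ = ζ ^ n := by rw [hr, one_mul]
    have := geom_sum_mul (ζ ^ m * star ζ ^ n) N
    have hp : (ζ ^ m * star ζ ^ n) ^ N = 1 := by
      rw [mul_pow, ← pow_mul, ← pow_mul, mul_comm m, mul_comm n, pow_mul, pow_mul, ← star_pow,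
        hζ.pow_eq_one]
      simp
    rw [hp, sub_self] at this
    exact (mul_eq_zero.1 this).resolve_right (sub_ne_zero.2 hr)

/-- A quadrature for the standard complex Gaussian that is exact in low degrees. -/
theorem exists_gaussian_quadrature (K : ℕ) :
    ∃ (ι : Type) (_ : Fintype ι) (w : ι → ℝ) (z : ι → ℂ), (∀ j, 0 ≤ w j) ∧
      ∀ m ≤ K, ∀ n ≤ K, ∑ j, (w j : ℂ) * (z j ^ m * star (z j) ^ n) =
        if m = n then (m.factorial : ℂ) else 0 := by
  obtain ⟨w, x, hw, hx, h⟩ := exists_exponential_quadrature K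
  have hζ := Complex.isPrimitiveRoot_exp (K + 1) (Nat.succ_ne_zero K)
  set ζ := Complex.exp (2 * Real.pi * Complex.I / (K + 1 : ℕ))
  -- In polar form a complex Gaussian has an exponential squared modulus and an independent uniform
  -- phase; K + 1 roots of unity separate all exponents up to K.
  refine ⟨Fin (K + 1) × Fin (K + 1), inferInstance, fun p => w p.1 / (K + 1),
    fun p => (√(x p.1) : ℝ) * ζ ^ (p.2 : ℕ), fun p => div_nonneg (hw _) (by positivity),
    fun m hm n hn => ?_⟩
  have hK : ((K : ℂ) + 1) ≠ 0 := by exact_mod_cast Nat.succ_ne_zero K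
  have key : ∀ i : Fin (K + 1), ∑ t : Fin (K + 1), (((w i / (K + 1) : ℝ) : ℂ)) *
      (((√(x i) : ℝ) * ζ ^ (t : ℕ)) ^ m * star ((√(x i) : ℝ) * ζ ^ (t : ℕ)) ^ n) =
      (w i * (√(x i) : ℝ) ^ m * (√(x i) : ℝ) ^ n) * if m = n then 1 else 0 := by
    intro i
    have := sum_pow_mul_star_pow_of_isPrimitiveRoot hζ (Nat.lt_succ_of_le hm)
      (Nat.lt_succ_of_le hn)
    calc _ = ∑ t : Fin (K + 1), ((w i * (√(x i) : ℝ) ^ m * (√(x i) : ℝ) ^ n) / (K + 1)) *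
          ((ζ ^ (t : ℕ)) ^ m * star (ζ ^ (t : ℕ)) ^ n) := by
          refine Finset.sum_congr rfl fun t _ => ?_
          rw [star_mul', mul_pow, mul_pow, Complex.star_def, Complex.conj_ofReal]
          push_cast
          ring
      _ = _ := by
          rw [← Finset.mul_sum, this]
          push_cast
          split_ifs
          · field_simp
          · simp
  rw [Fintype.sum_prod_type]
  simp only [key]
  split_ifs with hmn
  · subst hmn
    have : ∀ i, (w i * (√(x i) : ℝ) ^ m * (√(x i) : ℝ) ^ m : ℂ) = ((w i * x i ^ m : ℝ) : ℂ) := by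
      intro i
      rw [mul_assoc, ← mul_pow, ← Complex.ofReal_mul, Real.mul_self_sqrt (hx i)]
      push_cast
      rfl
    simp only [this, mul_one, ← Complex.ofReal_sum, h m hm]
    simp
  · simp

theorem prod_comp_eq_prod_pow_card {α b R : Type*} [Fintype α] [Fintype b] [DecidableEq b]
    [CommMonoid R] (h : b → R) (f : α → b) :
    ∏ j, h (f j) = ∏ i, h i ^ Fintype.card {j // f j = i} := by
  rw [← Finset.prod_fiberwise Finset.univ f]
  refine Finset.prod_congr rfl fun i _ => ?_
  rw [Finset.prod_congr rfl (g := fun _ => h i) (by simp +contextual), Finset.prod_const,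
    Fintype.card_subtype]

variable {b : Type*} [Fintype b] [DecidableEq b]

/-- The entry counts the π with f = g ∘ π. None exist unless the fibres of f and g have equal sizes;
otherwise they form a coset of the stabilizer of g, a product of symmetric groups of the fibres.
Each factor is a Gaussian moment. -/
theorem sum_permUnitary_apply {k : ℕ} (f g : Fin k → b) :
    (∑ π : Equiv.Perm (Fin k), permUnitary π) f g =
      ∏ i, if Fintype.card {j // f j = i} = Fintype.card {j // g j = i} then
        ((Fintype.card {j // f j = i}).factorial : ℂ) else 0 := by
  have h0 : (∑ π : Equiv.Perm (Fin k), permUnitary π) f g =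
      (Fintype.card {π : Equiv.Perm (Fin k) // f = g ∘ π} : ℂ) := by
    rw [Matrix.sum_apply, Fintype.card_subtype]
    simp [permUnitary]
  rw [h0]
  by_cases h : ∀ i, Fintype.card {j // f j = i} = Fintype.card {j // g j = i}
  · have hπ : ∃ π₀ : Equiv.Perm (Fin k), f = g ∘ π₀ :=
      ⟨Equiv.ofFiberEquiv fun i => Fintype.equivOfCardEq (h i),
        funext fun j => (Equiv.ofFiberEquiv_map _ j).symm⟩
    obtain ⟨π₀, rfl⟩ := hπ
    have e : Fintype.card {π : Equiv.Perm (Fin k) // g ∘ π₀ = g ∘ π} =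
        Fintype.card {π : Equiv.Perm (Fin k) // g ∘ π = g} := by
      refine Fintype.card_congr ((Equiv.mulRight π₀⁻¹).subtypeEquiv fun π => ?_)
      constructor
      · intro h
        ext j
        have := congrFun h (π₀⁻¹ j)
        simpa using this.symm
      · intro h
        ext j
        have := congrFun h (π₀ j)
        simpa using this.symm
    rw [e, DomMulAct.stabilizer_card]
    simp only [h, if_true, Nat.cast_prod]
  · have : IsEmpty {π : Equiv.Perm (Fin k) // f = g ∘ π} := by
      refine ⟨fun ⟨π, hπ⟩ => h fun i => Fintype.card_congr (π.subtypeEquiv fun j => ?_)⟩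
      rw [hπ]
      rfl
    push Not at h
    obtain ⟨i, hi⟩ := h
    rw [Fintype.card_eq_zero, Finset.prod_eq_zero (Finset.mem_univ i) (if_neg hi)]
    simp

/-- A finite weighted family of vectors whose `k`-th tensor powers average to the sum of the
permutation unitaries, for all small `k`. -/
theorem exists_symmetric_design (b : Type*) [Fintype b] [DecidableEq b] (K : ℕ) :
    ∃ (n : ℕ) (w : Fin n → ℝ) (ψ : Fin n → b → ℂ), (∀ y, 0 ≤ w y) ∧
      ∀ k ≤ K, ∀ f g : Fin k → b,
        ∑ y, (w y : ℂ) * ((∏ j, ψ y (f j)) * ∏ j, star (ψ y (g j))) =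
          (∑ π : Equiv.Perm (Fin k), permUnitary π) f g := by
  classical
  obtain ⟨ι, _, w, z, hw, h⟩ := exists_gaussian_quadrature K
  let e := (Fintype.equivFin (b → ι)).symm
  -- Product quadrature: the coordinates of the vector are independent copies of the scalar rule.
  refine ⟨_, fun y => ∏ i, w (e y i), fun y i => z (e y i),
    fun y => Finset.prod_nonneg fun i _ => hw _, fun k hk f g => ?_⟩
  rw [e.sum_comp (fun y : b → ι => (((∏ i, w (y i) : ℝ)) : ℂ) *
    ((∏ j, z (y (f j))) * ∏ j, star (z (y (g j)))))]
  have hcard : ∀ (f : Fin k → b) (i : b), Fintype.card {j // f j = i} ≤ K := fun f i =>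
    (Fintype.card_subtype_le _).trans (by simpa using hk)
  have e1 : ∀ y : b → ι, (((∏ i, w (y i) : ℝ)) : ℂ) *
      ((∏ j, z (y (f j))) * ∏ j, star (z (y (g j)))) =
      ∏ i, ((w (y i) : ℂ) * (z (y i) ^ Fintype.card {j // f j = i} *
        star (z (y i)) ^ Fintype.card {j // g j = i})) := by
    intro y
    rw [prod_comp_eq_prod_pow_card (fun i => z (y i)) f,
      prod_comp_eq_prod_pow_card (fun i => star (z (y i))) g, Finset.prod_mul_distrib,
      Finset.prod_mul_distrib, Complex.ofReal_prod]
  simp only [e1]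
  rw [sum_permUnitary_apply]
  simp only [← h _ (hcard f _) _ (hcard g _)]
  rw [Finset.prod_univ_sum, Fintype.piFinset_univ]

end

/-! ### Symmetric subspace and contractions of the design -/

section

variable {b : Type*} [Fintype b] [DecidableEq b] {k : ℕ}

omit [Fintype b] in
-- Permutations of k + 1 points are split by the image of 0: fixing 0 gives the first term, sending
-- it to i + 1 the i-th summand.
theorem sum_permUnitary_cons_apply (f g : Fin k → b) (p q : b) :
    (∑ π : Equiv.Perm (Fin (k + 1)), permUnitary π) (Fin.cons p f : Fin (k + 1) → b)
        (Fin.cons q g : Fin (k + 1) → b) =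
      (if p = q then (∑ π : Equiv.Perm (Fin k), permUnitary π) f g else 0) +
        ∑ i, if p = g i then
          (∑ π : Equiv.Perm (Fin k), permUnitary π) f (Function.update g i q) else 0 := by
  have key : ∀ (r : Fin (k + 1)) (e : Equiv.Perm (Fin k)),
      permUnitary (Equiv.Perm.decomposeFin.symm (r, e)) (Fin.cons p f : Fin (k + 1) → b)
        (Fin.cons q g : Fin (k + 1) → b) = if p = (Fin.cons q g : Fin (k + 1) → b) r then
          permUnitary e f (fun j => (Fin.cons q g : Fin (k + 1) → b) (Equiv.swap 0 r j.succ))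
          else 0 := by
    intro r e
    have : ((Fin.cons p f : Fin (k + 1) → b) =
        (Fin.cons q g : Fin (k + 1) → b) ∘ (Equiv.Perm.decomposeFin.symm (r, e))) ↔
        p = (Fin.cons q g : Fin (k + 1) → b) r ∧
          f = (fun j => (Fin.cons q g : Fin (k + 1) → b) (Equiv.swap 0 r j.succ)) ∘ e := by
      simp only [funext_iff, Fin.forall_fin_succ, Function.comp_apply, Fin.cons_zero, Fin.cons_succ,
        Equiv.Perm.decomposeFin_symm_apply_zero, Equiv.Perm.decomposeFin_symm_apply_succ]
    simp only [permUnitary, Matrix.of_apply, this, ite_and]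
  rw [Matrix.sum_apply, ← Equiv.Perm.decomposeFin.symm.sum_comp, Fintype.sum_prod_type,
    Fin.sum_univ_succ]
  simp only [key, Fin.cons_zero, Fin.cons_succ, Equiv.swap_self, Equiv.refl_apply,
    Matrix.sum_apply]
  congr 1
  · split_ifs <;> simp
  · refine Finset.sum_congr rfl fun i _ => ?_
    split_ifs with h
    · refine Finset.sum_congr rfl fun e _ => ?_
      congr 1
      ext j
      by_cases hj : j = i
      · subst hj
        simp
      · rw [Equiv.swap_apply_of_ne_of_ne (Fin.succ_ne_zero j) (by simpa using hj),
          Function.update_of_ne hj, Fin.cons_succ]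
    · simp

omit [Fintype b] in
theorem symProj_comp_right (π : Equiv.Perm (Fin k)) (f g : Fin k → b) :
    symProj b k f (g ∘ π) = symProj b k f g := by
  simp only [symProj, Matrix.smul_apply, Matrix.sum_apply]
  rw [← Equiv.sum_comp (Equiv.mulLeft π) fun τ => permUnitary τ f g]
  simp only [permUnitary, Matrix.of_apply, Equiv.coe_mulLeft, Equiv.Perm.coe_mul,
    Function.comp_assoc]
  rfl

omit [Fintype b] in
theorem symProj_comp_left (π : Equiv.Perm (Fin k)) (f g : Fin k → b) :
    symProj b k (f ∘ π) g = symProj b k f g := by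
  simp only [symProj, Matrix.smul_apply, Matrix.sum_apply]
  rw [← Equiv.sum_comp (Equiv.mulRight π) fun τ => permUnitary τ (f ∘ π) g]
  congr 1
  refine Finset.sum_congr rfl fun τ _ => ?_
  simp only [permUnitary, Matrix.of_apply, Equiv.coe_mulRight, Equiv.Perm.coe_mul,
    ← Function.comp_assoc, π.surjective.injective_comp_right.eq_iff]

variable {X : Matrix (Fin k → b) (Fin k → b) ℂ}

/-- Bose symmetry gives invariance in rows and columns separately, not only under simultaneous
permutation. -/
theorem apply_comp_right_of_symmetric (hX : X = symProj b k * X * symProj b k)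
    (π : Equiv.Perm (Fin k)) (f g : Fin k → b) : X f (g ∘ π) = X f g := by
  rw [hX, Matrix.mul_apply, Matrix.mul_apply]
  simp only [symProj_comp_right]

theorem apply_comp_left_of_symmetric (hX : X = symProj b k * X * symProj b k)
    (π : Equiv.Perm (Fin k)) (f g : Fin k → b) : X (f ∘ π) g = X f g := by
  rw [hX, Matrix.mul_assoc, Matrix.mul_apply, Matrix.mul_apply]
  simp only [symProj_comp_left]

theorem mul_sum_permUnitary_of_symmetric (hX : X = symProj b k * X * symProj b k) :
    X * ∑ π : Equiv.Perm (Fin k), permUnitary π = (k.factorial : ℂ) • X := by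
  ext f g
  have h : ∀ π : Equiv.Perm (Fin k), (X * (permUnitary π : Matrix (Fin k → b) (Fin k → b) ℂ)) f g = X f g := fun π => by
    rw [Matrix.mul_apply]
    simp [permUnitary, apply_comp_right_of_symmetric hX]
  rw [Finset.mul_sum, Matrix.sum_apply]
  simp [h, Fintype.card_perm]

theorem traceOthers_eq_of_symmetric (hX : X = symProj b k * X * symProj b k) (i j : Fin k) :
    traceOthers i X = traceOthers j X := by
  ext p q
  simp only [traceOthers, Matrix.of_apply]
  rw [← Equiv.sum_comp ((Equiv.swap i j).arrowCongr (Equiv.refl b))]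
  refine Finset.sum_congr rfl fun f _ => ?_
  have h1 : ((Equiv.swap i j).arrowCongr (Equiv.refl b)) f = f ∘ Equiv.swap i j := by
    ext x
    simp
  have h2 : Function.update (f ∘ Equiv.swap i j) i q =
      Function.update f j q ∘ Equiv.swap i j := by
    ext x
    by_cases hx : x = i
    · subst hx
      simp
    · have : Equiv.swap i j x ≠ j := fun h => hx ((Equiv.swap i j).injective (by simpa using h))
      simp [Function.update_of_ne hx, Function.update_of_ne this]
  rw [h1, h2, apply_comp_left_of_symmetric hX, apply_comp_right_of_symmetric hX]
  simp

theorem traceOthers_zero_apply {m : ℕ} (X : Matrix (Fin (m + 1) → b) (Fin (m + 1) → b) ℂ)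
    (p q : b) : traceOthers 0 X p q =
      ∑ g : Fin m → b, X (Fin.cons p g : Fin (m + 1) → b) (Fin.cons q g : Fin (m + 1) → b) := by
  simp only [traceOthers, Matrix.of_apply]
  rw [← Equiv.sum_comp (Fin.consEquiv fun _ : Fin (m + 1) => b), Fintype.sum_prod_type]
  simp [Fin.consEquiv]

theorem trace_traceOthers_zero {m : ℕ} (X : Matrix (Fin (m + 1) → b) (Fin (m + 1) → b) ℂ) :
    (traceOthers 0 X).trace = X.trace := by
  simp only [Matrix.trace, Matrix.diag, traceOthers_zero_apply]
  rw [← Equiv.sum_comp (Fin.consEquiv fun _ : Fin (m + 1) => b), Fintype.sum_prod_type]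
  simp [Fin.consEquiv]

/-- The tensor power of a vector. -/
def tensorPow (k : ℕ) (ψ : b → ℂ) : (Fin k → b) → ℂ := fun f => ∏ j, ψ (f j)

omit [Fintype b] [DecidableEq b] in
theorem tensorPow_comp_perm (ψ : b → ℂ) (π : Equiv.Perm (Fin k)) (f : Fin k → b) :
    tensorPow k ψ (f ∘ π) = tensorPow k ψ f :=
  Equiv.prod_comp π fun j => ψ (f j)

theorem symProj_mulVec_tensorPow (ψ : b → ℂ) :
    (symProj b k).mulVec (tensorPow k ψ) = tensorPow k ψ := by
  have h : ∀ π : Equiv.Perm (Fin k),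
      (permUnitary π).mulVec (tensorPow k ψ) = tensorPow k ψ := by
    intro π
    ext f
    have : ∀ g : Fin k → b, f = g ∘ π ↔ f ∘ π.symm = g := fun g =>
      ⟨fun h => by rw [h]; ext; simp, fun h => by rw [← h]; ext; simp⟩
    simp only [Matrix.mulVec, dotProduct, permUnitary, Matrix.of_apply, this, ite_mul, one_mul,
      zero_mul, Finset.sum_ite_eq, Finset.mem_univ, if_true]
    exact tensorPow_comp_perm ψ π.symm f
  rw [symProj, Matrix.smul_mulVec, Matrix.sum_mulVec]
  simp only [h, Finset.sum_const, Finset.card_univ, Fintype.card_perm, Fintype.card_fin]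
  rw [← Nat.cast_smul_eq_nsmul ℂ, smul_smul,
    inv_mul_cancel₀ (Nat.cast_ne_zero.2 k.factorial_ne_zero), one_smul]

theorem tensorPow_vecMul_symProj (ψ : b → ℂ) :
    Matrix.vecMul (star (tensorPow k ψ)) (symProj b k) = star (tensorPow k ψ) := by
  have h : ∀ π : Equiv.Perm (Fin k),
      Matrix.vecMul (star (tensorPow k ψ)) (permUnitary π) = star (tensorPow k ψ) := by
    intro π
    ext f
    simp only [Matrix.vecMul, dotProduct, permUnitary, Matrix.of_apply, mul_ite, mul_one,
      mul_zero, Finset.sum_ite_eq', Finset.mem_univ, if_true, Pi.star_apply,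
      tensorPow_comp_perm ψ π f]
  rw [symProj, Matrix.vecMul_smul, Matrix.vecMul_sum]
  simp only [h, Finset.sum_const, Finset.card_univ, Fintype.card_perm, Fintype.card_fin]
  rw [← Nat.cast_smul_eq_nsmul ℂ, smul_smul,
    inv_mul_cancel₀ (Nat.cast_ne_zero.2 k.factorial_ne_zero), one_smul]

omit [DecidableEq b] in
theorem sum_norm_sq_tensorPow {ψ : b → ℂ} (hψ : ∑ i, ‖ψ i‖ ^ 2 = 1) (k : ℕ) :
    ∑ f, ‖tensorPow k ψ f‖ ^ 2 = 1 := by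
  simp only [tensorPow, norm_prod, ← Finset.prod_pow]
  rw [← Fintype.piFinset_univ, ← Finset.prod_univ_sum (fun _ => Finset.univ)
    (fun _ i => ‖ψ i‖ ^ 2)]
  simp [hψ]

section Design

variable {n : ℕ} {w : Fin n → ℝ} {ψ : Fin n → b → ℂ}

/-- The factor ‖ψ‖² is the trace over one extra copy. Permutations fixing that copy contribute |B|,
and the others 1 for each of the k remaining copies. This is POVM completeness on the symmetric
subspace. -/
theorem sum_design_eq (hd : ∀ f g : Fin (k + 1) → b,
      ∑ y, (w y : ℂ) * ((∏ j, ψ y (f j)) * ∏ j, star (ψ y (g j))) =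
        (∑ π : Equiv.Perm (Fin (k + 1)), permUnitary π) f g) :
    ∑ y, ((w y * ∑ i, ‖ψ y i‖ ^ 2 : ℝ) : ℂ) •
        Matrix.vecMulVec (tensorPow k (ψ y)) (star (tensorPow k (ψ y))) =
      ((k.factorial : ℂ) * (k + Fintype.card b)) • symProj b k := by
  have hk : (k.factorial : ℂ) ≠ 0 := Nat.cast_ne_zero.2 k.factorial_ne_zero
  ext f g
  have h1 : ∀ y, (((w y * ∑ i, ‖ψ y i‖ ^ 2 : ℝ) : ℂ) •
      Matrix.vecMulVec (tensorPow k (ψ y)) (star (tensorPow k (ψ y)))) f g =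
      ∑ p, (w y : ℂ) * ((∏ j, ψ y ((Fin.cons p f : Fin (k + 1) → b) j)) *
        ∏ j, star (ψ y ((Fin.cons p g : Fin (k + 1) → b) j))) := by
    intro y
    simp only [Fin.prod_univ_succ, Fin.cons_zero, Fin.cons_succ, Matrix.smul_apply,
      Matrix.vecMulVec_apply, Pi.star_apply, tensorPow, star_prod, smul_eq_mul]
    push_cast
    rw [Finset.mul_sum, Finset.sum_mul]
    refine Finset.sum_congr rfl fun p _ => ?_
    rw [← Complex.mul_conj', Complex.star_def]
    ring
  rw [Matrix.sum_apply]
  simp only [h1]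
  rw [Finset.sum_comm]
  simp only [hd, sum_permUnitary_cons_apply, if_true, Finset.sum_add_distrib]
  rw [Finset.sum_comm (γ := b)]
  simp only [Finset.sum_ite_eq', Finset.mem_univ, if_true, Function.update_eq_self,
    Finset.sum_const, Finset.card_univ, Fintype.card_fin, nsmul_eq_mul, symProj,
    Matrix.smul_apply, smul_eq_mul]
  field_simp
  ring

/-- The measured k copies and the prepared one form a design on k + 1 copies. Permutations fixing
the prepared copy yield Tr X · 1; each of the k other classes yields a marginal of X, and all
marginals agree. -/
theorem sum_design_measure_prepare (hd : ∀ f g : Fin (k + 1) → b,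
      ∑ y, (w y : ℂ) * ((∏ j, ψ y (f j)) * ∏ j, star (ψ y (g j))) =
        (∑ π : Equiv.Perm (Fin (k + 1)), permUnitary π) f g)
    (hX : X = symProj b k * X * symProj b k) (i : Fin k) :
    ∑ y, ((w y : ℂ) * (Matrix.vecMulVec (tensorPow k (ψ y)) (star (tensorPow k (ψ y))) *
        X).trace) • Matrix.vecMulVec (ψ y) (star (ψ y)) =
      (k.factorial : ℂ) • (X.trace • (1 : Matrix b b ℂ) + (k : ℂ) • traceOthers i X) := by
  have hP : ∀ g h : Fin k → b, ∑ f, X g f * (∑ π : Equiv.Perm (Fin k), permUnitary π) f h =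
      k.factorial * X g h := by
    intro g h
    rw [← Matrix.mul_apply, mul_sum_permUnitary_of_symmetric hX, Matrix.smul_apply, smul_eq_mul]
  ext p q
  have h1 : ∀ y, (((w y : ℂ) * (Matrix.vecMulVec (tensorPow k (ψ y))
      (star (tensorPow k (ψ y))) * X).trace) • Matrix.vecMulVec (ψ y) (star (ψ y))) p q =
      ∑ f, ∑ g, X g f * ((w y : ℂ) * ((∏ j, ψ y ((Fin.cons p f : Fin (k + 1) → b) j)) *
        ∏ j, star (ψ y ((Fin.cons q g : Fin (k + 1) → b) j)))) := by
    intro y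
    simp only [Fin.prod_univ_succ, Fin.cons_zero, Fin.cons_succ, Matrix.smul_apply,
      Matrix.vecMulVec_apply, Pi.star_apply, tensorPow, star_prod, smul_eq_mul, Matrix.trace,
      Matrix.diag, Matrix.mul_apply]
    simp only [Finset.mul_sum, Finset.sum_mul]
    refine Finset.sum_congr rfl fun f _ => Finset.sum_congr rfl fun g _ => ?_
    ring
  rw [Matrix.sum_apply]
  simp only [h1]
  rw [Finset.sum_comm]
  simp only [Finset.sum_comm (s := (Finset.univ : Finset (Fin n)))]
  simp only [← Finset.mul_sum, hd, sum_permUnitary_cons_apply, mul_add, Finset.sum_add_distrib]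
  have e1 : ∑ f : Fin k → b, ∑ g, X g f *
      (if p = q then (∑ π : Equiv.Perm (Fin k), permUnitary π) f g else 0) =
      k.factorial * if p = q then X.trace else 0 := by
    rw [Finset.sum_comm]
    split_ifs
    · simp only [hP, ← Finset.mul_sum]
      rfl
    · simp
  have e2 : ∑ f : Fin k → b, ∑ g, X g f * (∑ i, if p = g i then
      (∑ π : Equiv.Perm (Fin k), permUnitary π) f (Function.update g i q) else 0) =
      k.factorial * (k * traceOthers i X p q) := by
    have h2 : ∀ i', ∑ g, ∑ f, X g f * (if p = g i' then
        (∑ π : Equiv.Perm (Fin k), permUnitary π) f (Function.update g i' q) else 0) =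
        k.factorial * traceOthers i X p q := by
      intro i'
      rw [traceOthers_eq_of_symmetric hX i i', traceOthers, Matrix.of_apply, Finset.mul_sum]
      refine Finset.sum_congr rfl fun g _ => ?_
      by_cases h : g i' = p
      · simp only [h, if_true, hP]
      · simp [h, Ne.symm h]
    rw [Finset.sum_comm]
    simp only [Finset.mul_sum (s := (Finset.univ : Finset (Fin k)))]
    simp only [Finset.sum_comm (s := (Finset.univ : Finset (Fin k → b)))
      (t := (Finset.univ : Finset (Fin k)))]
    simp only [h2, Finset.sum_const, Finset.card_univ, Fintype.card_fin, nsmul_eq_mul]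
    ring
  rw [e1, e2]
  simp only [Matrix.smul_apply, Matrix.add_apply, Matrix.one_apply, smul_eq_mul, mul_ite, mul_one,
    mul_zero, mul_add]

end Design

end

/-! ### Complete positivity and the two classes of maps -/

section

open Matrix

section Positivity

variable {n : Type*} [Fintype n] [DecidableEq n]

theorem posSemidef_of_forall_dotProduct_nonneg {M : Matrix n n ℂ}
    (h : ∀ x, 0 ≤ star x ⬝ᵥ (M *ᵥ x)) : M.PosSemidef := by
  rw [← isPositive_toEuclideanLin_iff, LinearMap.isPositive_iff_complex]
  intro x
  have e : inner ℂ (toEuclideanLin M x) x = star (star x.ofLp ⬝ᵥ (M *ᵥ x.ofLp)) := by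
    rw [← inner_conj_symm, EuclideanSpace.inner_eq_star_dotProduct, dotProduct_comm]
    rfl
  obtain ⟨h1, h2⟩ := Complex.le_def.1 (h x.ofLp)
  rw [e]
  refine ⟨Complex.ext (by simp) ?_, ?_⟩
  · simpa using h2.symm
  · simpa using h1

end Positivity

section IdTensor

variable {a b c : Type*} [Fintype a] [Fintype b] [Fintype c]

theorem IsChannel.posSemidef_idTensor {Λ : Matrix b b ℂ →ₗ[ℂ] Matrix c c ℂ} (hΛ : IsChannel Λ)
    {X : Matrix (a × b) (a × b) ℂ} (hX : X.PosSemidef) : (idTensor a Λ X).PosSemidef := by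
  let e := Fintype.equivFin a
  have h := (hΛ.1 _ _ (hX.submatrix fun p : Fin (Fintype.card a) × b => (e.symm p.1, p.2))).submatrix
    fun p : a × c => (e p.1, p.2)
  convert h using 1
  ext s t
  simp [idTensor]

theorem IsChannel.posSemidef_apply {Λ : Matrix b b ℂ →ₗ[ℂ] Matrix c c ℂ} (hΛ : IsChannel Λ)
    {X : Matrix b b ℂ} (hX : X.PosSemidef) : (Λ X).PosSemidef := by
  have h := (hΛ.posSemidef_idTensor (a := Unit) (hX.submatrix Prod.snd)).submatrix
    fun p : c => ((), p)
  exact h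

theorem trace_idTensor {Λ : Matrix b b ℂ →ₗ[ℂ] Matrix c c ℂ}
    (hΛ : ∀ X : Matrix b b ℂ, (Λ X).trace = X.trace) (X : Matrix (a × b) (a × b) ℂ) :
    (idTensor a Λ X).trace = X.trace := by
  simp only [trace, diag, Fintype.sum_prod_type]
  exact Finset.sum_congr rfl fun s _ => hΛ (Matrix.of fun u v => X (s, u) (s, v))

variable [DecidableEq a] [DecidableEq b]

/-- Partial evaluation of a positive operator against a positive operator on the second factor. -/
theorem posSemidef_trace_mul_block {M : Matrix b b ℂ} (hM : M.PosSemidef)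
    {X : Matrix (a × b) (a × b) ℂ} (hX : X.PosSemidef) :
    (Matrix.of fun s t => (M * Matrix.of fun u v => X (s, u) (t, v)).trace).PosSemidef := by
  refine posSemidef_of_forall_dotProduct_nonneg fun x => ?_
  -- W = x ⊗ 1, so the quadratic form at x becomes Tr(M Wᴴ X W).
  let W : Matrix (a × b) b ℂ := Matrix.of fun p v => if p.2 = v then x p.1 else 0
  have h := trace_mul_nonneg_of_posSemidef hM (hX.conjTranspose_mul_mul_same W)
  convert h using 1
  have hW : ∀ u v, (Wᴴ * X * W) u v = ∑ t, ∑ s, star (x s) * X (s, u) (t, v) * x t := by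
    intro u v
    simp [W, mul_apply, Fintype.sum_prod_type, apply_ite, Finset.sum_mul]
  have h1 : ∀ Y : Matrix b b ℂ, (M * Y).trace = ∑ u, ∑ v, M u v * Y v u := fun Y => rfl
  simp only [h1, hW, dotProduct, mulVec, of_apply, Pi.star_apply, Finset.mul_sum, Finset.sum_mul]
  rw [Finset.sum_comm]
  simp only [Finset.sum_comm (s := (Finset.univ : Finset a)) (t := (Finset.univ : Finset b))]
  refine Finset.sum_congr rfl fun u _ => Finset.sum_congr rfl fun v _ =>
    Finset.sum_congr rfl fun t _ => Finset.sum_congr rfl fun s _ => ?_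
  ring

/-- The image is ∑ Tr_B(M_y X) ⊗ N_y, a sum of products of positive operators. -/
theorem posSemidef_idTensor_of_measure_prepare {n : ℕ} {M : Fin n → Matrix b b ℂ}
    {N : Fin n → Matrix c c ℂ} (hM : ∀ y, (M y).PosSemidef) (hN : ∀ y, (N y).PosSemidef)
    {Λ : Matrix b b ℂ →ₗ[ℂ] Matrix c c ℂ} (hΛ : ∀ X, Λ X = ∑ y, (M y * X).trace • N y)
    {X : Matrix (a × b) (a × b) ℂ} (hX : X.PosSemidef) : (idTensor a Λ X).PosSemidef := by
  have e : idTensor a Λ X = ∑ y, kroneckerMap (· * ·)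
      (Matrix.of fun s t => (M y * Matrix.of fun u v => X (s, u) (t, v)).trace) (N y) := by
    ext s t
    simp [idTensor, hΛ, Matrix.sum_apply]
  classical
  rw [e]
  exact posSemidef_sum _ fun y _ => (posSemidef_trace_mul_block (hM y) hX).kronecker (hN y)

end IdTensor

section Classes

variable {a b : Type*} [Fintype a] [DecidableEq a] [Fintype b] [DecidableEq b]

omit [DecidableEq a] in
theorem isState_idTensor_of_mem_boseExtendible {k : ℕ} {Λ : Matrix b b ℂ →ₗ[ℂ] Matrix b b ℂ}
    (hΛ : Λ ∈ boseExtendible b k) {ρ : Matrix (a × b) (a × b) ℂ} (hρ : IsState ρ) :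
    IsState (idTensor a Λ ρ) := by
  obtain ⟨hk, Γ, hΓ, -, h⟩ := hΛ
  obtain ⟨m, rfl⟩ : ∃ m, k = m + 1 := ⟨k - 1, by omega⟩
  change ∀ X, Λ X = traceOthers 0 (Γ X) at h
  constructor
  · have e : idTensor a Λ ρ = ∑ g : Fin m → b, (idTensor a Γ ρ).submatrix
        (fun p : a × b => (p.1, (Fin.cons p.2 g : Fin (m + 1) → b)))
        (fun p : a × b => (p.1, (Fin.cons p.2 g : Fin (m + 1) → b))) := by
      ext s t
      simp [idTensor, h, traceOthers_zero_apply, Matrix.sum_apply]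
    rw [e]
    exact posSemidef_sum _ fun g _ => (hΓ.posSemidef_idTensor hρ.1).submatrix _
  · rw [trace_idTensor (fun X => by rw [h, trace_traceOthers_zero, hΓ.2]), hρ.2]

omit [DecidableEq b] in
theorem trace_vecMulVec_star {β : b → ℂ} (hβ : ∑ i, ‖β i‖ ^ 2 = 1) :
    (vecMulVec β (star β)).trace = 1 := by
  simp only [trace, diag, vecMulVec_apply, Pi.star_apply, Complex.star_def, Complex.mul_conj']
  exact_mod_cast hβ

/-- The extension prepares β^{⊗k} in place of β. -/
theorem entanglementBreaking_subset_boseExtendible {k : ℕ} (hk : 0 < k) :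
    entanglementBreaking b ⊆ boseExtendible b k := by
  rintro Λ ⟨n, M, β, hM, hM1, hβ, hΛ⟩
  let Γ : Matrix b b ℂ →ₗ[ℂ] Matrix (Fin k → b) (Fin k → b) ℂ :=
    { toFun := fun X => ∑ y, (M y * X).trace •
        vecMulVec (tensorPow k (β y)) (star (tensorPow k (β y)))
      map_add' := fun X Y => by
        simp [Matrix.mul_add, add_smul, Finset.sum_add_distrib]
      map_smul' := fun z X => by
        simp [Finset.smul_sum, smul_smul] }
  have hΓ : ∀ X, Γ X = ∑ y, (M y * X).trace •
        vecMulVec (tensorPow k (β y)) (star (tensorPow k (β y))) := fun X => rfl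
  refine ⟨hk, Γ, ⟨fun n X hX => posSemidef_idTensor_of_measure_prepare hM
    (fun y => posSemidef_vecMulVec_self_star _) hΓ hX, fun X => ?_⟩, fun X => ?_, fun X => ?_⟩
  · rw [hΓ, trace_sum]
    simp only [trace_smul, trace_vecMulVec_star (sum_norm_sq_tensorPow (hβ _) k), smul_eq_mul,
      mul_one]
    rw [← trace_sum, ← Finset.sum_mul, hM1, Matrix.one_mul]
  · rw [hΓ, Finset.mul_sum, Finset.sum_mul]
    refine Finset.sum_congr rfl fun y _ => ?_
    rw [Matrix.mul_smul, Matrix.smul_mul, mul_vecMulVec, vecMulVec_mul, symProj_mulVec_tensorPow,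
      tensorPow_vecMul_symProj]
  · obtain ⟨m, rfl⟩ : ∃ m, k = m + 1 := ⟨k - 1, by omega⟩
    change Λ X = traceOthers 0 (Γ X)
    ext p q
    rw [hΛ, traceOthers_zero_apply, hΓ]
    simp only [Matrix.sum_apply, Matrix.smul_apply, vecMulVec_apply, Pi.star_apply, tensorPow,
      Fin.prod_univ_succ, Fin.cons_zero, Fin.cons_succ, smul_eq_mul]
    rw [Finset.sum_comm]
    refine Finset.sum_congr rfl fun y _ => ?_
    have h1 := trace_vecMulVec_star (sum_norm_sq_tensorPow (hβ y) m)
    simp only [trace, diag, vecMulVec_apply, Pi.star_apply, tensorPow] at h1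
    calc _ = (M y * X).trace * (β y p * star (β y q)) * 1 := by ring
      _ = _ := by
        rw [← h1, Finset.mul_sum]
        refine Finset.sum_congr rfl fun g _ => ?_
        rw [star_mul']
        ring

/-- The adjoint of a linear map for the trace pairing. -/
theorem exists_trace_adjoint {c : Type*} [Fintype c] (Γ : Matrix b b ℂ →ₗ[ℂ] Matrix c c ℂ)
    (N : Matrix c c ℂ) : ∃ M : Matrix b b ℂ, ∀ X, (M * X).trace = (N * Γ X).trace := by
  refine ⟨Matrix.of fun u v => (N * Γ (single v u 1)).trace, fun X => ?_⟩
  conv_rhs => rw [matrix_eq_sum_single X]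
  simp only [map_sum, Finset.mul_sum, trace_sum]
  simp only [trace, diag, mul_apply (M := Matrix.of _), of_apply]
  rw [Finset.sum_comm]
  refine Finset.sum_congr rfl fun v _ => Finset.sum_congr rfl fun u _ => ?_
  have : single v u (X v u) = X v u • single v u (1 : ℂ) := by simp
  rw [this, map_smul, Matrix.mul_smul]
  simp [Finset.mul_sum, mul_comm]

theorem posSemidef_of_trace_adjoint {c : Type*} [Fintype c] [DecidableEq c]
    {Γ : Matrix b b ℂ →ₗ[ℂ] Matrix c c ℂ}
    (hΓ : IsChannel Γ) {N : Matrix c c ℂ} (hN : N.PosSemidef) {M : Matrix b b ℂ}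
    (h : ∀ X, (M * X).trace = (N * Γ X).trace) : M.PosSemidef := by
  refine posSemidef_of_forall_dotProduct_nonneg fun x => ?_
  have := trace_mul_nonneg_of_posSemidef hN
    (hΓ.posSemidef_apply (posSemidef_vecMulVec_self_star x))
  rw [← h, mul_vecMulVec, trace_vecMulVec, dotProduct_comm] at this
  exact this

/-- Design vectors are not normalized; their squared norms move into the POVM weights. For ψ = 0 any
unit vector serves. -/
theorem exists_unit_vector_smul [Nonempty b] (ψ : b → ℂ) :
    ∃ β : b → ℂ, ∑ i, ‖β i‖ ^ 2 = 1 ∧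
      ((∑ i, ‖ψ i‖ ^ 2 : ℝ) : ℂ) • vecMulVec β (star β) = vecMulVec ψ (star ψ) := by
  have h0 : 0 ≤ ∑ i, ‖ψ i‖ ^ 2 := Finset.sum_nonneg fun i _ => sq_nonneg _
  rcases h0.eq_or_lt with h | h
  · have hψ : ψ = 0 := by
      ext i
      have := (Finset.sum_eq_zero_iff_of_nonneg fun i _ => sq_nonneg ‖ψ i‖).1 h.symm i
        (Finset.mem_univ i)
      simpa using this
    refine ⟨Pi.single (Classical.arbitrary b) 1, ?_, ?_⟩
    · rw [Finset.sum_eq_single (Classical.arbitrary b)]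
      · simp
      · intro i _ hi
        simp [hi]
      · simp
    · simp [hψ]
  · set s := ∑ i, ‖ψ i‖ ^ 2
    refine ⟨((√s)⁻¹ : ℂ) • ψ, ?_, ?_⟩
    · simp only [Pi.smul_apply, norm_smul, mul_pow, ← Finset.mul_sum]
      rw [norm_inv, Complex.norm_real, Real.norm_of_nonneg (Real.sqrt_nonneg s), inv_pow,
        Real.sq_sqrt h0]
      exact inv_mul_cancel₀ h.ne'
    · ext p q
      have hs : ((√s : ℝ) : ℂ) * ((√s : ℝ) : ℂ) = s := by
        rw [← Complex.ofReal_mul, Real.mul_self_sqrt h0]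
      have hs0 : ((√s : ℝ) : ℂ) ≠ 0 := Complex.ofReal_ne_zero.2 (Real.sqrt_pos.2 h).ne'
      simp only [Matrix.smul_apply, vecMulVec_apply, Pi.smul_apply, Pi.star_apply, smul_eq_mul, star_mul',
        Complex.star_def, map_inv₀, Complex.conj_ofReal, ← hs]
      field_simp

/-- The measure-and-prepare map built from a symmetric extension: it mixes the extendible map with
the completely depolarizing one. -/
theorem exists_entanglementBreaking_of_mem_boseExtendible [Nonempty b] {k : ℕ}
    {Λ : Matrix b b ℂ →ₗ[ℂ] Matrix b b ℂ} (hΛ : Λ ∈ boseExtendible b k) :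
    ∃ Λ' ∈ entanglementBreaking b, ∀ X,
      Λ' X = ((k / (k + Fintype.card b) : ℝ) : ℂ) • Λ X +
        ((1 / (k + Fintype.card b) : ℝ) : ℂ) • X.trace • (1 : Matrix b b ℂ) := by
  obtain ⟨hk, Γ, hΓ, hsym, h⟩ := hΛ
  obtain ⟨n, w, ψ, hw, hd⟩ := exists_symmetric_design b (k + 1)
  -- One copy more than is measured: the extra one is prepared.
  replace hd := hd (k + 1) le_rfl
  choose β hβ1 hβ using fun y => exists_unit_vector_smul (ψ y)
  have hs : ∀ y, 0 ≤ ∑ i, ‖ψ y i‖ ^ 2 := fun y => Finset.sum_nonneg fun i _ => sq_nonneg _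
  have hd0 : (0 : ℝ) < k + Fintype.card b := by positivity
  have hD : ((k : ℂ) + Fintype.card b) ≠ 0 := by exact_mod_cast hd0.ne'
  have hF : (k.factorial : ℂ) ≠ 0 := Nat.cast_ne_zero.2 k.factorial_ne_zero
  set c : ℝ := (k.factorial * (k + Fintype.card b))⁻¹ with hc
  have hc0 : 0 ≤ c := by positivity
  have hcC : (c : ℂ) = ((k.factorial : ℂ) * (k + Fintype.card b))⁻¹ := by
    rw [hc]
    push_cast
    rfl
  let N : Fin n → Matrix (Fin k → b) (Fin k → b) ℂ := fun y =>
    (c : ℂ) • ((w y * ∑ i, ‖ψ y i‖ ^ 2 : ℝ) : ℂ) •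
      vecMulVec (tensorPow k (ψ y)) (star (tensorPow k (ψ y)))
  have hN : ∀ y, (N y).PosSemidef := fun y =>
    ((posSemidef_vecMulVec_self_star _).smul (Complex.zero_le_real.2 (mul_nonneg (hw y) (hs y)))).smul
      (Complex.zero_le_real.2 hc0)
  -- Summing to the projector rather than to 1 suffices: the outputs of Γ are symmetric, so the
  -- pullbacks `M y` along Γ still sum to 1.
  have hN1 : ∑ y, N y = symProj b k := by
    rw [← Finset.smul_sum, sum_design_eq hd, smul_smul, hcC,
      inv_mul_cancel₀ (mul_ne_zero hF hD), one_smul]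
  choose M hM using fun y => exists_trace_adjoint Γ (N y)
  have htr : ∀ X, (symProj b k * Γ X).trace = (Γ X).trace := by
    intro X
    rw [trace_mul_comm, symProj, Matrix.mul_smul, mul_sum_permUnitary_of_symmetric (hsym X),
      smul_smul, inv_mul_cancel₀ hF, one_smul]
  let Λ' : Matrix b b ℂ →ₗ[ℂ] Matrix b b ℂ :=
    ((k / (k + Fintype.card b) : ℝ) : ℂ) • Λ +
      ((1 / (k + Fintype.card b) : ℝ) : ℂ) • (traceLinearMap b ℂ ℂ).smulRight (1 : Matrix b b ℂ)
  have hΛ' : ∀ X, Λ' X = ((k / (k + Fintype.card b) : ℝ) : ℂ) • Λ X +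
        ((1 / (k + Fintype.card b) : ℝ) : ℂ) • X.trace • (1 : Matrix b b ℂ) := fun X => rfl
  refine ⟨Λ', ⟨n, M, β, fun y => posSemidef_of_trace_adjoint hΓ (hN y) (hM y), ?_, hβ1,
    fun X => ?_⟩, hΛ'⟩
  · refine ext_iff_trace_mul_right.2 fun X => ?_
    rw [Finset.sum_mul, trace_sum]
    simp only [hM]
    rw [← trace_sum, ← Finset.sum_mul, hN1, htr, hΓ.2, Matrix.one_mul]
  · have e : ∀ y, (M y * X).trace • vecMulVec (β y) (star (β y)) =
        (c : ℂ) • ((w y : ℂ) * (vecMulVec (tensorPow k (ψ y)) (star (tensorPow k (ψ y))) *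
          Γ X).trace) • vecMulVec (ψ y) (star (ψ y)) := by
      intro y
      rw [hM, ← hβ y]
      simp only [N, Matrix.smul_mul, trace_smul, smul_smul, smul_eq_mul]
      congr 1
      push_cast
      ring
    simp only [e]
    rw [← Finset.smul_sum, sum_design_measure_prepare hd (hsym X) ⟨0, hk⟩, ← h, hΛ', hΓ.2, hcC]
    simp only [smul_add, smul_smul]
    rw [add_comm]
    congr 2
    · push_cast
      field_simp
    · push_cast
      field_simp

end Classes

end

/-! ### Suprema of fidelities and the comparison of classes -/

section

open Matrix

/-- Links the surprisal, a supremum of squares, to `supFidelity`. -/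
theorem sSup_image_sq {α : Type*} {s : Set α} (hs : s.Nonempty) {f : α → ℝ}
    (h0 : ∀ x ∈ s, 0 ≤ f x) (hb : BddAbove (f '' s)) :
    sSup ((fun x => f x ^ 2) '' s) = sSup (f '' s) ^ 2 := by
  have hle : ∀ x ∈ s, f x ≤ sSup (f '' s) := fun x hx => le_csSup hb (Set.mem_image_of_mem f hx)
  have hle2 : ∀ x ∈ s, f x ^ 2 ≤ sSup (f '' s) ^ 2 := fun x hx =>
    pow_le_pow_left₀ (h0 x hx) (hle x hx) 2
  have hb2 : BddAbove ((fun x => f x ^ 2) '' s) :=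
    ⟨sSup (f '' s) ^ 2, Set.forall_mem_image.2 hle2⟩
  refine le_antisymm (csSup_le (hs.image _) (Set.forall_mem_image.2 hle2)) ?_
  have h : sSup (f '' s) ≤ √(sSup ((fun x => f x ^ 2) '' s)) :=
    csSup_le (hs.image _) (Set.forall_mem_image.2 fun x hx =>
      Real.le_sqrt_of_sq_le (le_csSup hb2 (Set.mem_image_of_mem (fun x => f x ^ 2) hx)))
  obtain ⟨x, hx⟩ := hs
  exact (Real.le_sqrt ((h0 x hx).trans (hle x hx))
    ((sq_nonneg (f x)).trans (le_csSup hb2 (Set.mem_image_of_mem (fun x => f x ^ 2) hx)))).1 h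

variable {a b : Type*} [Fintype a] [DecidableEq a] [Fintype b] [DecidableEq b]
  {ρ : Matrix (a × b) (a × b) ℂ}

theorem fidelity_idTensor_comm {k : ℕ} {Λ : Matrix b b ℂ →ₗ[ℂ] Matrix b b ℂ}
    (hΛ : Λ ∈ boseExtendible b k) (hρ : IsState ρ) :
    fidelity ρ (idTensor a Λ ρ) = fidelity (idTensor a Λ ρ) ρ :=
  fidelity_comm hρ.1 (isState_idTensor_of_mem_boseExtendible hΛ hρ).1

theorem bddAbove_fidelity {k : ℕ} {L : Set (Matrix b b ℂ →ₗ[ℂ] Matrix b b ℂ)}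
    (hL : L ⊆ boseExtendible b k) (hρ : IsState ρ) :
    BddAbove ((fun Λ => fidelity ρ (idTensor a Λ ρ)) '' L) :=
  ⟨1, Set.forall_mem_image.2 fun _ hΛ =>
    fidelity_le_one hρ (isState_idTensor_of_mem_boseExtendible (hL hΛ) hρ)⟩

theorem surprisal_eq {k : ℕ} {L : Set (Matrix b b ℂ →ₗ[ℂ] Matrix b b ℂ)}
    (hL : L ⊆ boseExtendible b k) (hL0 : L.Nonempty) (hρ : IsState ρ) :
    surprisal L ρ = -Real.logb 2 (supFidelity L ρ ^ 2) := by
  rw [supFidelity, ← sSup_image_sq hL0 (fun _ _ => fidelity_nonneg _ _) (bddAbove_fidelity hL hρ),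
    surprisal]
  congr 3
  exact Set.image_congr fun Λ hΛ => by rw [fidelity_idTensor_comm (hL hΛ) hρ]

omit [DecidableEq a] [DecidableEq b] in
theorem nonempty_of_isState (hρ : IsState ρ) : Nonempty b := by
  by_contra h
  rw [not_nonempty_iff] at h
  simpa [trace] using hρ.2

/-- Preparing the maximally mixed state has positive fidelity of recovery. -/
theorem exists_entanglementBreaking_fidelity_pos (hρ : IsState ρ) :
    ∃ Λ ∈ entanglementBreaking b, 0 < fidelity ρ (idTensor a Λ ρ) := by
  have : Nonempty b := nonempty_of_isState hρ
  have hd : (0 : ℝ) < Fintype.card b := by exact_mod_cast Fintype.card_pos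
  have hd' : (Fintype.card b : ℂ) ≠ 0 := by exact_mod_cast hd.ne'
  let e := (Fintype.equivFin b).symm
  let Λ : Matrix b b ℂ →ₗ[ℂ] Matrix b b ℂ :=
    ((Fintype.card b : ℂ)⁻¹) • (traceLinearMap b ℂ ℂ).smulRight (1 : Matrix b b ℂ)
  have hΛ : ∀ X, Λ X = (Fintype.card b : ℂ)⁻¹ • X.trace • (1 : Matrix b b ℂ) := fun X => rfl
  have hmem : Λ ∈ entanglementBreaking b := by
    refine ⟨Fintype.card b, fun _ => (Fintype.card b : ℂ)⁻¹ • (1 : Matrix b b ℂ),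
      fun y => Pi.single (e y) 1, fun y => PosSemidef.one.smul ?_, ?_, fun y => ?_, fun X => ?_⟩
    · simp
    · rw [Finset.sum_const, Finset.card_univ, Fintype.card_fin, ← Nat.cast_smul_eq_nsmul ℂ,
        smul_smul, mul_inv_cancel₀ hd', one_smul]
    · rw [Finset.sum_eq_single (e y)]
      · simp
      · intro i _ hi
        simp [hi]
      · simp
    · rw [hΛ]
      simp only [Matrix.smul_mul, Matrix.one_mul, trace_smul, smul_eq_mul]
      rw [← Finset.smul_sum, smul_smul,
        e.sum_comp fun i => vecMulVec (Pi.single i (1 : ℂ)) (star (Pi.single i (1 : ℂ)))]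
      congr 1
      ext p q
      rw [Matrix.sum_apply, one_apply]
      simp only [vecMulVec_apply, Pi.star_apply, Pi.single_apply, apply_ite star, star_one,
        star_zero, mul_ite, mul_one, mul_zero]
      rw [Finset.sum_eq_single q]
      · simp
      · intro i _ hi
        simp [Ne.symm hi]
      · simp
  refine ⟨Λ, hmem, fidelity_pos hρ.1 (isState_idTensor_of_mem_boseExtendible
    (entanglementBreaking_subset_boseExtendible Nat.one_pos hmem) hρ).1 ?_⟩
  -- A is the reduced state ρ_A, and the overlap of ρ with ρ_A ⊗ 1/|B| is Tr(ρ_A²)/|B|, which is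
  -- nonzero.
  set A : Matrix a a ℂ := Matrix.of fun s t => ∑ u, ρ (s, u) (t, u) with hA
  have hAt : A.trace = 1 := by
    rw [← hρ.2]
    simp [A, trace, Fintype.sum_prod_type]
  have hAh : Aᴴ = A := by
    ext s t
    simp only [A, conjTranspose_apply, of_apply, star_sum]
    exact Finset.sum_congr rfl fun u _ => hρ.1.1.apply _ _
  have htr : (ρ * idTensor a Λ ρ).trace = (Fintype.card b : ℂ)⁻¹ * (Aᴴ * A).trace := by
    rw [hAh]
    simp only [trace, diag, mul_apply, Fintype.sum_prod_type, Finset.mul_sum]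
    refine Finset.sum_congr rfl fun s _ => ?_
    rw [Finset.sum_comm]
    refine Finset.sum_congr rfl fun t _ => ?_
    have : ∀ u v, idTensor a Λ ρ (t, v) (s, u) =
        if v = u then (Fintype.card b : ℂ)⁻¹ * A t s else 0 := by
      intro u v
      change Λ (Matrix.of fun u v => ρ (t, u) (s, v)) v u = _
      rw [hΛ]
      simp [A, trace, one_apply]
    simp only [this, mul_ite, mul_zero, Finset.sum_ite_eq', Finset.mem_univ, if_true]
    rw [← Finset.sum_mul]
    change A s t * _ = _
    ring
  rw [htr]
  refine mul_ne_zero (inv_ne_zero hd') fun h0 => ?_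
  rw [trace_conjTranspose_mul_self_eq_zero_iff] at h0
  rw [h0, trace_zero] at hAt
  exact zero_ne_one hAt

/-- With c = k/(k+d) in [0, 1], 1 - √c ≤ 1 - c = d/(k+d); this lies in [0, 1] and below 2d/k, so its
square is at most 2d/k. -/
theorem one_sub_sqrt_div_le {d k : ℝ} (hd : 0 ≤ d) (hk : 0 < k) :
    1 - √(k / (k + d)) ≤ √(2 * d / k) := by
  have hkd : 0 < k + d := by positivity
  have h1 : k / (k + d) ≤ √(k / (k + d)) :=
    Real.le_sqrt_of_sq_le (by
      have h0 : 0 ≤ k / (k + d) := by positivity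
      have h1 : k / (k + d) ≤ 1 := (div_le_one hkd).2 (by linarith)
      nlinarith)
  have h2 : 1 - k / (k + d) = d / (k + d) := by
    field_simp
    ring
  have h3 : d / (k + d) ≤ √(2 * d / k) := by
    refine Real.le_sqrt_of_sq_le ?_
    have h4 : 0 ≤ d / (k + d) := by positivity
    have h5 : d / (k + d) ≤ 1 := (div_le_one hkd).2 (by linarith)
    have h6 : d / (k + d) ≤ 2 * d / k :=
      div_le_div₀ (by linarith) (by linarith) hk (by linarith)
    nlinarith
  linarith

/-- Bose-symmetric extendible maps recover hardly better than entanglement-breaking ones. -/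
theorem exists_entanglementBreaking_fidelity_ge {k : ℕ}
    {Λ : Matrix b b ℂ →ₗ[ℂ] Matrix b b ℂ} (hΛ : Λ ∈ boseExtendible b k) (hρ : IsState ρ) :
    ∃ Λ' ∈ entanglementBreaking b, fidelity ρ (idTensor a Λ ρ) - √(2 * Fintype.card b / k) ≤
      fidelity ρ (idTensor a Λ' ρ) := by
  have : Nonempty b := nonempty_of_isState hρ
  have hk : (0 : ℝ) < k := by exact_mod_cast hΛ.1
  obtain ⟨Λ', hΛ', h⟩ := exists_entanglementBreaking_of_mem_boseExtendible hΛ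
  refine ⟨Λ', hΛ', ?_⟩
  set σ := idTensor a Λ ρ with hσdef
  have hσ : IsState σ := isState_idTensor_of_mem_boseExtendible hΛ hρ
  set c : ℝ := k / (k + Fintype.card b) with hc
  have hc0 : 0 ≤ c := by positivity
  have hc' : (0 : ℂ) ≤ ((1 / (k + Fintype.card b) : ℝ) : ℂ) :=
    Complex.zero_le_real.2 (by positivity)
  -- The remainder is a nonnegative multiple of ρ_A ⊗ 1.
  have hdiff : (idTensor a Λ' ρ - (c : ℂ) • σ).PosSemidef := by
    have e : idTensor a Λ' ρ - (c : ℂ) • σ = ((1 / (k + Fintype.card b) : ℝ) : ℂ) •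
        idTensor a ((traceLinearMap b ℂ ℂ).smulRight (1 : Matrix b b ℂ)) ρ := by
      ext s t
      simp [σ, idTensor, h]
    rw [e]
    exact (posSemidef_idTensor_of_measure_prepare (n := 1) (M := fun _ => 1) (N := fun _ => 1)
      (fun _ => PosSemidef.one) (fun _ => PosSemidef.one) (fun X => by simp) hρ.1).smul hc'
  have h1 := fidelity_mono (hσ.1.smul (Complex.zero_le_real.2 hc0)) hdiff ρ
  rw [fidelity_smul hc0 hσ.1, ← fidelity_idTensor_comm hΛ hρ, ← fidelity_idTensor_comm
    (entanglementBreaking_subset_boseExtendible Nat.one_pos hΛ') hρ] at h1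
  have h2 := fidelity_le_one hρ hσ
  have h3 := fidelity_nonneg ρ σ
  have h4 := one_sub_sqrt_div_le (Nat.cast_nonneg (α := ℝ) (Fintype.card b)) hk
  rw [← hc] at h4
  have h5 : fidelity ρ σ * (1 - √c) ≤ √(2 * Fintype.card b / k) := by
    rcases le_total 0 (1 - √c) with h6 | h6
    · exact (mul_le_of_le_one_left h6 h2).trans h4
    · exact (mul_nonpos_of_nonneg_of_nonpos h3 h6).trans (Real.sqrt_nonneg _)
  rw [← hσdef] at h1
  linarith

end

end QDiscord

theorem mainTheorem1 {a b : Type*} [Fintype a] [DecidableEq a] [Fintype b] [DecidableEq b]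
    (ρ : Matrix (a × b) (a × b) ℂ) (hρ : QDiscord.IsState ρ) :
    0 < QDiscord.supFidelity (QDiscord.entanglementBreaking b) ρ ∧
    (∀ k : ℕ, 1 ≤ k →
      0 < QDiscord.supFidelity (QDiscord.boseExtendible b k) ρ ∧
      QDiscord.supFidelity (QDiscord.entanglementBreaking b) ρ ≥
        QDiscord.supFidelity (QDiscord.boseExtendible b k) ρ
          - Real.sqrt (2 * (Fintype.card b : ℝ) / (k : ℝ))) ∧
    Tendsto (fun k : ℕ => QDiscord.surprisal (QDiscord.boseExtendible b k) ρ) atTop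
      (𝓝 (QDiscord.surprisal (QDiscord.entanglementBreaking b) ρ)) := by
  open QDiscord in
  obtain ⟨Λ₀, hΛ₀, hpos⟩ := exists_entanglementBreaking_fidelity_pos hρ
  have hsub : ∀ k : ℕ, 1 ≤ k → entanglementBreaking b ⊆ boseExtendible b k :=
    fun k hk => entanglementBreaking_subset_boseExtendible hk
  have hbE := bddAbove_fidelity (hsub 1 le_rfl) hρ
  have hE : 0 < supFidelity (entanglementBreaking b) ρ :=
    hpos.trans_le (le_csSup hbE (Set.mem_image_of_mem _ hΛ₀))
  have hmono : ∀ k : ℕ, 1 ≤ k → supFidelity (entanglementBreaking b) ρ ≤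
      supFidelity (boseExtendible b k) ρ := fun k hk =>
    csSup_le_csSup (bddAbove_fidelity subset_rfl hρ) ⟨_, Set.mem_image_of_mem _ hΛ₀⟩
      (Set.image_mono (hsub k hk))
  have hle : ∀ k : ℕ, 1 ≤ k → supFidelity (boseExtendible b k) ρ ≤
      supFidelity (entanglementBreaking b) ρ + √(2 * (Fintype.card b : ℝ) / (k : ℝ)) := by
    refine fun k hk => csSup_le ⟨_, Set.mem_image_of_mem _ (hsub k hk hΛ₀)⟩
      (Set.forall_mem_image.2 fun Λ hΛ => ?_)
    obtain ⟨Λ', hΛ', h⟩ := exists_entanglementBreaking_fidelity_ge hΛ hρ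
    have := le_csSup hbE (Set.mem_image_of_mem (fun Λ => fidelity ρ (idTensor a Λ ρ)) hΛ')
    exact sub_le_iff_le_add.1 (h.trans this)
  refine ⟨hE, fun k hk => ⟨hE.trans_le (hmono k hk), sub_le_iff_le_add.2 (hle k hk)⟩, ?_⟩
  have hlim : Tendsto (fun k : ℕ => √(2 * (Fintype.card b : ℝ) / (k : ℝ))) atTop (𝓝 0) := by
    have := (tendsto_const_div_atTop_nhds_zero_nat (2 * (Fintype.card b : ℝ))).sqrt
    simpa using this
  have hsup : Tendsto (fun k : ℕ => supFidelity (boseExtendible b k) ρ) atTop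
      (𝓝 (supFidelity (entanglementBreaking b) ρ)) := by
    refine tendsto_of_tendsto_of_tendsto_of_le_of_le' tendsto_const_nhds
      (by simpa using hlim.const_add (supFidelity (entanglementBreaking b) ρ))
      (eventually_atTop.2 ⟨1, hmono⟩) (eventually_atTop.2 ⟨1, hle⟩)
  rw [surprisal_eq (hsub 1 le_rfl) ⟨Λ₀, hΛ₀⟩ hρ]
  -- Only k ≥ 1 is usable, since the extendible class is empty at k = 0.
  refine Tendsto.congr' (eventually_atTop.2 ⟨1, fun k hk =>
    (surprisal_eq subset_rfl ⟨Λ₀, hsub k hk hΛ₀⟩ hρ).symm⟩) ?_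
  exact ((hsup.pow 2).log (pow_ne_zero 2 hE.ne')).div_const _ |>.neg
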